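/- Let $\mathcal{A}$ be a finite discrete alphabet. A shift on $\mathcal{A}$ is a nonempty compact $X \subseteq \mathcal{A}^{\mathbb{Z}}$ with $TX = X$, where $(Tx)(j) = x(j+1)$. It is a $1$-step shift of finite type if there is $\mathcal{F} \subseteq \mathcal{A}^2$ such that $X = \{x \in \mathcal{A}^{\mathbb{Z}} : (x(j), x(j+1)) \notin \mathcal{F} \text{ for all } j \in \mathbb{Z}\}$. It is called transitive if there is $D \in \mathbb{N}$ such that for all $x_1, x_2 \in X$ and all $b_1, a_2 \in \mathbb{Z}$ with $a_2 - b_1 \geq D$ there is $x' \in X$ with $x'(j) = x_1(j)$ for all $j \leq b_1$ and $x'(j) = x_2(j)$ for all $j \geq a_2$. Let $(X, T)$ and $(Y, S)$ be transitive $1$-step shifts of finite type on $\mathcal{A}$, and let $f \in C(X \times Y)$ be a real-valued function for which there is $F : \mathcal{A}^2 \to \mathbb{R}$ with $f(x, y) = F(x(0), y(0))$ for all $(x, y) \in X \times Y$. Let $\mathcal{M}_S(Y)$ and $\mathcal{M}_{T \times S}(X \times Y)$ be the sets of invariant Borel probability measures. Let $\pi_Y : X \times Y \to Y$ be the projection.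 For $\nu \in \mathcal{M}_S(Y)$ put $$\psi_f(\nu) = \min\left\{ \int f \, \mathrm{d}\lambda : \lambda \in \mathcal{M}_{T \times S}(X \times Y), \ (\pi_Y)_* \lambda = \nu \right\}.$$ A measure $\nu_0 \in \mathcal{M}_S(Y)$ is $\alpha$-maximizing if $\psi_f(\nu) \leq \psi_f(\nu_0)$ for all $\nu \in \mathcal{M}_S(Y)$. Let $\mathcal{M}_S^{co}(Y)$ be the set of measures $\frac{1}{k} \sum_{j=0}^{k-1} \delta_{S^j y}$ with $k \geq 1$, $y \in Y$ and $S^k y = y$. For integers $a \leq b$ let $P_{a,b} = \{(x(a), x(b)) : x \in X\}$. For $(v_1, v_2) \in P_{a,b}$ and $y \in Y$ let $$H_{a,b,v_1,v_2}(y) = \min\left\{ \sum_{j=a}^{b} f(T^j x, S^j y) : x \in X, \ x(a) = v_1, \ x(b) = v_2 \right\}.$$ For $C \geq 0$, a point $y' \in Y$ is an $(f, C)$-improvement of $y \in Y$ on $[a, b]$ if $y'(j) = y(j)$ for all $j \in \mathbb{Z} \setminus [a, b]$ and $H_{a,b,v_1,v_2}(y) + C < H_{a,b,v_1,v_2}(y')$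 for all $(v_1, v_2) \in P_{a,b}$. Let $Y_{f,C}$ be the set of all $y \in Y$ that have no $(f, C)$-improvement on any $[a, b]$ with $a \leq b$. Then for each $C \geq 0$ the following conditions are equivalent: 1. There exists $\nu_0 \in \mathcal{M}_S^{co}(Y)$ which is $\alpha$-maximizing. 2. $Y_{f,C}$ contains a periodic point, i.e. a point $y$ with $S^k y = y$ for some $k \geq 1$. -/

import Mathlib

open MeasureTheory

noncomputable section

namespace AdversarialErgodic

/-! ### Invariant measures and maximizing measures -/

section Dynamics

variable {Y Z : Type*} [TopologicalSpace Y] [MeasurableSpace Y] [TopologicalSpace Z]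
  [MeasurableSpace Z]

/-- The invariant (Borel) probability measures of the system `(Z, U)`. -/
def invariantMeasures (U : Z ≃ₜ Z) : Set (Measure Z) :=
  {μ | IsProbabilityMeasure μ ∧ MeasurePreserving U μ μ}

/-- The average `𝔸_k μ = (1 / k) ∑_{j < k} (U ^ j)_* μ`. -/
def averageMeasure (U : Z ≃ₜ Z) (k : ℕ) (μ : Measure Z) : Measure Z :=
  (k : ENNReal)⁻¹ • ∑ j ∈ Finset.range k, μ.map (U^[j])

/-- The invariant probability measures supported on a periodic orbit: the measures
`𝔸_k δ_z` with `k ≥ 1` and `U ^ k z = z`. -/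
def closedOrbitMeasures (U : Z ≃ₜ Z) : Set (Measure Z) :=
  {μ | μ ∈ invariantMeasures U ∧ ∃ k : ℕ, 0 < k ∧ ∃ z : Z, Function.IsPeriodicPt U k z ∧
    μ = averageMeasure U k (Measure.dirac z)}

/-- `ψ_f(ν)`: the minimum of `∫ f dλ` over the `U`-invariant probability measures `λ` on `Z`
whose image under `π` is `ν`. -/
def psi (U : Z ≃ₜ Z) (π : Z → Y) (f : C(Z, ℝ)) (ν : Measure Y) : ℝ :=
  sInf ((fun μ : Measure Z => ∫ z, f z ∂μ) '' {μ | μ ∈ invariantMeasures U ∧ μ.map π = ν})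

/-- `ν₀` is `α`-maximizing: it is an `S`-invariant probability measure at which `ψ_f` attains its
supremum over all `S`-invariant probability measures. -/
def IsAlphaMaximizing (U : Z ≃ₜ Z) (S : Y ≃ₜ Y) (π : Z → Y) (f : C(Z, ℝ)) (ν₀ : Measure Y) :
    Prop :=
  ν₀ ∈ invariantMeasures S ∧ ∀ ν ∈ invariantMeasures S, psi U π f ν ≤ psi U π f ν₀

/-- The orbit sum `𝕊_{[a, b]} f = ∑_{a ≤ j ≤ b} f ∘ U ^ j`. -/
def orbitSum (U : Z ≃ₜ Z) (f : C(Z, ℝ)) (a b : ℤ) (z : Z) : ℝ :=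
  ∑ j ∈ Finset.Icc a b, f ((U ^ j) z)

end Dynamics

/-! ### Shifts -/

/-- The left shift `(T x) j = x (j + 1)` on `A^ℤ`. -/
def leftShift (A : Type*) [TopologicalSpace A] : (ℤ → A) ≃ₜ (ℤ → A) where
  toFun x j := x (j + 1)
  invFun x j := x (j - 1)
  left_inv x := by funext j; simp
  right_inv x := by funext j; simp
  continuous_toFun := by fun_prop
  continuous_invFun := by fun_prop

/-- A shift on `A`: a nonempty compact `X ⊆ A^ℤ` with `T X = X`. -/
structure Subshift (A : Type*) [TopologicalSpace A] where
  carrier : Set (ℤ → A)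
  nonempty : carrier.Nonempty
  isCompact : IsCompact carrier
  image_shift : leftShift A '' carrier = carrier

namespace Subshift

variable {A : Type*} [TopologicalSpace A]

instance : CoeSort (Subshift A) (Type _) := ⟨fun X => X.carrier⟩

theorem mem_iff_shift_mem (X : Subshift A) (x : ℤ → A) :
    x ∈ X.carrier ↔ leftShift A x ∈ X.carrier := by
  conv_rhs => rw [← X.image_shift]
  exact ((leftShift A).injective.mem_set_image).symm

/-- The left shift as a homeomorphism of the shift space `X`. -/
def shift (X : Subshift A) : X ≃ₜ X :=
  (leftShift A).subtype X.mem_iff_shift_mem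

/-- `X` is an `M`-step shift of finite type: it is given by a set of forbidden words of length
`M + 1`. -/
def IsStepSFT (X : Subshift A) (M : ℕ) : Prop :=
  ∃ 𝓕 : Set (Fin (M + 1) → A),
    X.carrier = {x | ∀ j : ℤ, (fun i : Fin (M + 1) => x (j + (i : ℕ))) ∉ 𝓕}

/-- Transitivity of a shift, in the uniform form: any left half of a point can be glued to any
right half of another point across any gap of length at least a constant `D`. -/
def IsTransitive (X : Subshift A) : Prop :=
  ∃ D : ℕ, ∀ x₁ x₂ : X, ∀ b₁ a₂ : ℤ, (D : ℤ) ≤ a₂ - b₁ →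
    ∃ x' : X, (∀ j ≤ b₁, x'.1 j = x₁.1 j) ∧ (∀ j ≥ a₂, x'.1 j = x₂.1 j)

end Subshift

/-! ### Improvements and generalized ground states -/

section GroundStates

variable {A : Type*} [TopologicalSpace A]

/-- `P_{a, b}`: the pairs of letters that occur at positions `a` and `b` of a point of `X`. -/
def endpointPairs (X : Subshift A) (a b : ℤ) : Set (A × A) :=
  {v | ∃ x : X, x.1 a = v.1 ∧ x.1 b = v.2}

/-- `H_{a, b, v₁, v₂}(y)`: the minimum of `𝕊_{[a, b]} f (x, y)` over the `x ∈ X` with `x a = v₁`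
and `x b = v₂`. -/
def minSum (X Y : Subshift A) (f : C(X × Y, ℝ)) (a b : ℤ) (v : A × A) (y : Y) : ℝ :=
  sInf ((fun x : X => orbitSum (X.shift.prodCongr Y.shift) f a b (x, y)) ''
    {x | x.1 a = v.1 ∧ x.1 b = v.2})

/-- `y'` is an `(f, C)`-improvement of `y` on `[a, b]`. -/
def IsImprovement (X Y : Subshift A) (f : C(X × Y, ℝ)) (C : ℝ) (a b : ℤ) (y y' : Y) : Prop :=
  (∀ j : ℤ, j ∉ Set.Icc a b → y.1 j = y'.1 j) ∧
    ∀ v ∈ endpointPairs X a b, minSum X Y f a b v y + C < minSum X Y f a b v y'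

/-- `Y_{f, C}`: the points of `Y` that cannot be `(f, C)`-improved on any `[a, b]`, `a ≤ b`. -/
def groundStates (X Y : Subshift A) (f : C(X × Y, ℝ)) (C : ℝ) : Set Y :=
  {y | ∀ a b : ℤ, a ≤ b → ¬ ∃ y' : Y, IsImprovement X Y f C a b y y'}

end GroundStates

end AdversarialErgodic

end

open AdversarialErgodic

/-!
The boundary conditions in `H` are immaterial up to bounded errors. Let `minCost n y` be the minimum
of `∑ j < n, F (x j) (y j)` over all `x ∈ X`. Gluing changes a cost by at most a constant, so
`n * ψ_f(ν) = ∫ minCost n dν + O(1)` uniformly in `n`: the lower bound is invariance, and for the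
upper bound one concatenates optimal blocks into a factor map between powers of `S` and `T`
and averages its graph measure. On the orbit of a periodic point `y` this reads
`n * ψ_f = minCost n y + O(1)`.

If `y` has no improvement, then `minCost n z ≤ minCost n y + O(1)` for every `z ∈ Y`, since
otherwise gluing a long stretch of `z` into `y` improves `y`. Integrating over `z`, dividing by `n`
and letting `n → ∞` shows that a periodic such `y` carries a maximizing measure. Conversely,
repeating an improvement of a periodic `y` periodically yields a periodic `z` whose minimal cost
exceeds that of `y` by a fixed amount `δ > 0` in each period, so `ψ_f` is larger on the orbit of
`z`.
-/

noncomputable section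

namespace AdversarialErgodic

/-! ### Averages of measures along orbits -/

section BirkhoffSums

variable {α β E : Type*} [NormedAddCommGroup E] [NormedSpace ℝ E] {U : α → α} {g : α → E}

theorem norm_birkhoffAverage_sub_le {k : ℕ} (hk : 0 < k) {z : α} {ε : ℝ}
    (h : ∀ j < k, ‖g (U^[j] z) - g z‖ ≤ ε) :
    ‖birkhoffAverage ℝ U g k z - g z‖ ≤ ε := by
  have hk' : (0 : ℝ) < k := Nat.cast_pos.2 hk
  have hsum : birkhoffAverage ℝ U g k z - g z =
      (k : ℝ)⁻¹ • ∑ j ∈ Finset.range k, (g (U^[j] z) - g z) := by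
    rw [Finset.sum_sub_distrib, Finset.sum_const, Finset.card_range, smul_sub,
      ← Nat.cast_smul_eq_nsmul ℝ, inv_smul_smul₀ hk'.ne']
    rfl
  have hnorm := norm_sum_le_of_le (Finset.range k) fun j hj => h j (Finset.mem_range.1 hj)
  rw [Finset.sum_const, Finset.card_range, nsmul_eq_mul] at hnorm
  rwa [hsum, norm_smul, norm_inv, Real.norm_natCast, inv_mul_le_iff₀ hk']

theorem natCast_smul_integral_birkhoffAverage [MeasurableSpace β] {k : ℕ} (hk : 0 < k)
    (φ : β → α) (μ : Measure β) :
    (k : ℝ) • ∫ b, birkhoffAverage ℝ U g k (φ b) ∂μ = ∫ b, birkhoffSum U g k (φ b) ∂μ := by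
  simp only [birkhoffAverage]
  rw [integral_smul, smul_inv_smul₀ (Nat.cast_ne_zero.2 hk.ne')]

end BirkhoffSums

theorem integrable_birkhoffSum_comp {α β E : Type*} [MeasurableSpace α] [MeasurableSpace β]
    [NormedAddCommGroup E] {U : α → α} {g : α → E} (hU : Measurable U) (hg : StronglyMeasurable g)
    {M : ℝ} (hM : ∀ a, ‖g a‖ ≤ M) {φ : β → α} (hφ : Measurable φ) (k : ℕ) (μ : Measure β)
    [IsFiniteMeasure μ] : Integrable (fun b => birkhoffSum U g k (φ b)) μ :=
  integrable_finsetSum _ fun j _ =>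
    Integrable.of_bound (hg.comp_measurable ((hU.iterate j).comp hφ)).aestronglyMeasurable M
      (Filter.Eventually.of_forall fun _ => hM _)

section Averages

variable {X Y Z E : Type*} [TopologicalSpace X] [MeasurableSpace X] [TopologicalSpace Y]
  [MeasurableSpace Y] [TopologicalSpace Z] [MeasurableSpace Z] [NormedAddCommGroup E]
  [NormedSpace ℝ E]

theorem averageMeasure_eq_self {U : Z ≃ₜ Z} {k : ℕ} (hk : 0 < k) {μ : Measure Z}
    (hμ : MeasurePreserving U μ μ) : averageMeasure U k μ = μ := by
  rw [averageMeasure, Finset.sum_congr rfl fun j _ => (hμ.iterate j).map_eq, Finset.sum_const,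
    Finset.card_range, ← Nat.cast_smul_eq_nsmul ENNReal, smul_smul,
    ENNReal.inv_mul_cancel (Nat.cast_ne_zero.2 hk.ne') (ENNReal.natCast_ne_top k), one_smul]

theorem map_averageMeasure {U : Z ≃ₜ Z} {S : Y ≃ₜ Y} {π : Z → Y} (hU : Measurable U)
    (hS : Measurable S) (hπ : Measurable π) (h : Function.Semiconj π U S) (k : ℕ)
    (μ : Measure Z) : (averageMeasure U k μ).map π = averageMeasure S k (μ.map π) := by
  rw [averageMeasure, averageMeasure, Measure.map_smul, Measure.map_finset_sum hπ.aemeasurable]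
  refine congrArg _ (Finset.sum_congr rfl fun j _ => ?_)
  rw [Measure.map_map hπ (hU.iterate j), Measure.map_map (hS.iterate j) hπ,
    (h.iterate_right j).comp_eq]

theorem averageMeasure_mem_invariantMeasures {U : Z ≃ₜ Z} (hU : Measurable U) {k : ℕ}
    (hk : 0 < k) {μ : Measure Z} [IsProbabilityMeasure μ] (hμ : μ.map U^[k] = μ) :
    averageMeasure U k μ ∈ invariantMeasures U := by
  refine ⟨⟨?_⟩, hU, ?_⟩
  · have hmass : ∀ j ∈ Finset.range k, μ.map U^[j] Set.univ = 1 := fun j _ => by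
      rw [Measure.map_apply (hU.iterate j) MeasurableSet.univ, Set.preimage_univ, measure_univ]
    rw [averageMeasure, Measure.smul_apply, Measure.finsetSum_apply,
      Finset.sum_congr rfl hmass, Finset.sum_const, Finset.card_range, nsmul_one, smul_eq_mul]
    exact ENNReal.inv_mul_cancel (Nat.cast_ne_zero.2 hk.ne') (ENNReal.natCast_ne_top k)
  · have hshift : ∀ j, (μ.map U).map U^[j] = μ.map U^[j + 1] := fun j => by
      rw [Measure.map_map (hU.iterate j) hU, Function.iterate_succ]
    rw [map_averageMeasure hU hU hU (Function.Commute.refl _), averageMeasure, averageMeasure,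
      Finset.sum_congr rfl fun j _ => hshift j]
    obtain ⟨m, rfl⟩ := Nat.exists_eq_succ_of_ne_zero hk.ne'
    rw [Finset.sum_range_succ, Finset.sum_range_succ' (fun j => μ.map U^[j]), hμ,
      Function.iterate_zero, Measure.map_id]

theorem averageMeasure_dirac_mem_closedOrbitMeasures {U : Z ≃ₜ Z} (hU : Measurable U) {k : ℕ}
    (hk : 0 < k) {z : Z} (hz : Function.IsPeriodicPt U k z) :
    averageMeasure U k (Measure.dirac z) ∈ closedOrbitMeasures U := by
  refine ⟨averageMeasure_mem_invariantMeasures hU hk ?_, k, hk, z, hz, rfl⟩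
  rw [Measure.map_dirac' (hU.iterate k), hz.eq]

theorem integral_averageMeasure {U : Z ≃ₜ Z} (hU : Measurable U) (k : ℕ) {μ : Measure Z}
    {g : Z → E} (hg : StronglyMeasurable g)
    (hint : ∀ j < k, Integrable (fun z => g (U^[j] z)) μ) :
    ∫ z, g z ∂averageMeasure U k μ = ∫ z, birkhoffAverage ℝ U g k z ∂μ := by
  simp only [birkhoffAverage, birkhoffSum]
  rw [averageMeasure, integral_smul_measure, integral_finsetSum_measure, integral_smul,
    integral_finsetSum _ fun j hj => hint j (Finset.mem_range.1 hj), ENNReal.toReal_inv,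
    ENNReal.toReal_natCast]
  · exact congrArg _ (Finset.sum_congr rfl fun j _ =>
      integral_map (hU.iterate j).aemeasurable hg.aestronglyMeasurable)
  · exact fun j hj => (integrable_map_measure hg.aestronglyMeasurable
      (hU.iterate j).aemeasurable).2 (hint j (Finset.mem_range.1 hj))

theorem integral_averageMeasure_dirac [CompleteSpace E] {U : Z ≃ₜ Z} (hU : Measurable U) (k : ℕ)
    (z : Z) {g : Z → E} (hg : StronglyMeasurable g) :
    ∫ w, g w ∂averageMeasure U k (Measure.dirac z) = birkhoffAverage ℝ U g k z := by
  have hj : ∀ j, StronglyMeasurable fun w => g (U^[j] w) := fun j =>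
    hg.comp_measurable (hU.iterate j)
  rw [integral_averageMeasure hU k hg fun j _ => integrable_dirac' (hj j) enorm_lt_top]
  refine integral_dirac' _ _ (StronglyMeasurable.const_smul ?_ _)
  exact Finset.stronglyMeasurable_fun_sum _ fun j _ => hj j

/-- The joining of an `S`-invariant measure `ν` with a `T`-invariant one that a factor map `Φ`
between the powers `S ^ N` and `T ^ N` induces: the graph measure of `Φ` is invariant under
`(T × S) ^ N`, and averaging it over `N` steps makes it invariant under `T × S`. -/
def graphJoining (T : X ≃ₜ X) (S : Y ≃ₜ Y) (N : ℕ) (Φ : Y → X) (ν : Measure Y) :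
    Measure (X × Y) :=
  averageMeasure (T.prodCongr S) N (ν.map fun y => (Φ y, y))

theorem graphJoining_mem_invariantMeasures {T : X ≃ₜ X} {S : Y ≃ₜ Y} {N : ℕ} {Φ : Y → X}
    {ν : Measure Y} (hT : Measurable T) (hN : 0 < N) (hΦ : Measurable Φ)
    (hsemi : Function.Semiconj Φ S^[N] T^[N]) (hν : ν ∈ invariantMeasures S) :
    graphJoining T S N Φ ν ∈ invariantMeasures (T.prodCongr S) := by
  obtain ⟨_, hpres⟩ := hν
  have hU : Measurable (T.prodCongr S) := hT.prodMap hpres.measurable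
  have hgraph : Measurable fun y => (Φ y, y) := hΦ.prodMk measurable_id
  have := Measure.isProbabilityMeasure_map (μ := ν) hgraph.aemeasurable
  refine averageMeasure_mem_invariantMeasures hU hN ?_
  have hcomm : (T.prodCongr S)^[N] ∘ (fun y => (Φ y, y)) = (fun y => (Φ y, y)) ∘ S^[N] := by
    funext y
    simp only [Function.comp_apply, Homeomorph.coe_prodCongr, Prod.map_iterate, Prod.map_apply,
      hsemi.eq]
  rw [Measure.map_map (hU.iterate N) hgraph, hcomm,
    ← Measure.map_map hgraph (hpres.measurable.iterate N), (hpres.iterate N).map_eq]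

theorem map_snd_graphJoining {T : X ≃ₜ X} {S : Y ≃ₜ Y} {N : ℕ} {Φ : Y → X} {ν : Measure Y}
    (hT : Measurable T) (hN : 0 < N) (hΦ : Measurable Φ) (hν : MeasurePreserving S ν ν) :
    (graphJoining T S N Φ ν).map Prod.snd = ν := by
  rw [graphJoining, map_averageMeasure (hT.prodMap hν.measurable) hν.measurable measurable_snd
    fun _ => rfl]
  have hmarginal : (ν.map fun y => (Φ y, y)).map Prod.snd = ν := by
    rw [Measure.map_map measurable_snd (hΦ.prodMk measurable_id')]
    exact Measure.map_id
  rw [hmarginal, averageMeasure_eq_self hN hν]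

theorem integral_graphJoining {T : X ≃ₜ X} {S : Y ≃ₜ Y} {N : ℕ} {Φ : Y → X} {ν : Measure Y}
    [IsFiniteMeasure ν] (hT : Measurable T) (hS : Measurable S) (hΦ : Measurable Φ)
    {g : X × Y → E} (hg : StronglyMeasurable g) {M : ℝ} (hM : ∀ z, ‖g z‖ ≤ M) :
    ∫ z, g z ∂graphJoining T S N Φ ν =
      ∫ y, birkhoffAverage ℝ (T.prodCongr S) g N (Φ y, y) ∂ν := by
  have hU : Measurable (T.prodCongr S) := hT.prodMap hS
  have hj : ∀ j, StronglyMeasurable fun z => g ((T.prodCongr S)^[j] z) := fun j =>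
    hg.comp_measurable (hU.iterate j)
  rw [graphJoining, integral_averageMeasure hU N hg fun j _ =>
    Integrable.of_bound (hj j).aestronglyMeasurable M (Filter.Eventually.of_forall fun z => hM _)]
  refine integral_map (hΦ.prodMk measurable_id).aemeasurable
    (StronglyMeasurable.const_smul ?_ _).aestronglyMeasurable
  exact Finset.stronglyMeasurable_fun_sum _ fun j _ => hj j

end Averages

/-! ### Cutting and pasting points of a shift -/

section Shifts

theorem prodCongr_zpow_apply {X Y : Type*} [TopologicalSpace X] [TopologicalSpace Y] (T : X ≃ₜ X)
    (S : Y ≃ₜ Y) (n : ℤ) (z : X × Y) :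
    (T.prodCongr S ^ n) z = ((T ^ n) z.1, (S ^ n) z.2) := by
  let φ : (X ≃ₜ X) × (Y ≃ₜ Y) →* (X × Y ≃ₜ X × Y) :=
    { toFun := fun e => e.1.prodCongr e.2
      map_one' := rfl
      map_mul' := fun _ _ => rfl }
  exact DFunLike.congr_fun (map_zpow φ (T, S) n).symm z

namespace Subshift

variable {A : Type*} [TopologicalSpace A]

theorem shift_iterate_apply (X : Subshift A) (x : X) (n : ℕ) (j : ℤ) :
    (X.shift^[n] x).1 j = x.1 (j + n) := by
  induction n generalizing j with
  | zero => simp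
  | succ n ih =>
    rw [Function.iterate_succ_apply']
    exact (ih (j + 1)).trans (congrArg x.1 (by push_cast; ring))

theorem shift_zpow_apply (X : Subshift A) (x : X) (n j : ℤ) :
    ((X.shift ^ n) x).1 j = x.1 (j + n) := by
  induction n generalizing x with
  | zero => simp
  | succ n ih =>
    rw [zpow_add_one, Homeomorph.mul_apply, ih]
    exact congrArg x.1 (by ring)
  | pred n ih =>
    rw [zpow_sub_one, Homeomorph.mul_apply, ih]
    exact congrArg x.1 (by ring)

theorem isPeriodicPt_shift_iff (X : Subshift A) (x : X) (k : ℕ) :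
    Function.IsPeriodicPt X.shift k x ↔ Function.Periodic x.1 k := by
  rw [Function.IsPeriodicPt, Function.IsFixedPt, Subtype.ext_iff, funext_iff]
  exact forall_congr' fun j => by rw [X.shift_iterate_apply]

/-- `D` is a gluing gap of `X`: it witnesses the transitivity of `X`. -/
def IsGluingGap (X : Subshift A) (D : ℕ) : Prop :=
  ∀ x₁ x₂ : X, ∀ b₁ a₂ : ℤ, (D : ℤ) ≤ a₂ - b₁ →
    ∃ x' : X, (∀ j ≤ b₁, x'.1 j = x₁.1 j) ∧ (∀ j ≥ a₂, x'.1 j = x₂.1 j)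

theorem IsTransitive.exists_isGluingGap {X : Subshift A} (hX : X.IsTransitive) :
    ∃ D : ℕ, X.IsGluingGap D := hX

namespace IsGluingGap

theorem mono {X : Subshift A} {D D' : ℕ} (hD : X.IsGluingGap D) (h : D ≤ D') :
    X.IsGluingGap D' :=
  fun x₁ x₂ b₁ a₂ hgap => hD x₁ x₂ b₁ a₂ (by omega)

theorem exists_glue_middle {X : Subshift A} {D : ℕ} (hD : X.IsGluingGap D) (x₁ x₂ x₃ : X)
    {b₁ a₂ b₂ a₃ : ℤ} (hb : b₁ ≤ b₂) (h₁₂ : (D : ℤ) ≤ a₂ - b₁) (h₂₃ : (D : ℤ) ≤ a₃ - b₂) :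
    ∃ x : X, (∀ j ≤ b₁, x.1 j = x₁.1 j) ∧ (∀ j, a₂ ≤ j → j ≤ b₂ → x.1 j = x₂.1 j) ∧
      ∀ j ≥ a₃, x.1 j = x₃.1 j := by
  obtain ⟨u, hu₁, hu₂⟩ := hD x₁ x₂ b₁ a₂ h₁₂
  obtain ⟨x, hxu, hx₃⟩ := hD u x₃ b₂ a₃ h₂₃
  exact ⟨x, fun j hj => (hxu j (hj.trans hb)).trans (hu₁ j hj),
    fun j ha hb => (hxu j hb).trans (hu₂ j ha), hx₃⟩

end IsGluingGap

end Subshift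

/-- The concatenation of the blocks `s q 0, …, s q (p - 1)`, `q ∈ ℤ`, the block number `q`
being placed on `[q * p, (q + 1) * p)`. -/
def concat {A : Type*} (p : ℤ) (s : ℤ → ℤ → A) : ℤ → A := fun j => s (j / p) (j % p)

theorem concat_apply {A : Type*} {p : ℤ} (s : ℤ → ℤ → A) (q : ℤ) {r : ℤ} (h₀ : 0 ≤ r)
    (h₁ : r < p) : concat p s (q * p + r) = s q r := by
  have hp : p ≠ 0 := (h₀.trans_lt h₁).ne'
  rw [concat, add_comm, Int.add_mul_ediv_right _ _ hp, Int.ediv_eq_zero_of_lt h₀ h₁, zero_add,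
    Int.add_mul_emod_self_right, Int.emod_eq_of_lt h₀ h₁]

namespace Subshift.IsStepSFT

variable {A : Type*} [TopologicalSpace A] {X : Subshift A}

theorem exists_rel (hX : X.IsStepSFT 1) :
    ∃ R : A → A → Prop, ∀ x, x ∈ X.carrier ↔ ∀ j : ℤ, R (x j) (x (j + 1)) := by
  obtain ⟨𝓕, h𝓕⟩ := hX
  refine ⟨fun a b => ![a, b] ∉ 𝓕, fun x => ?_⟩
  have hword : ∀ j : ℤ, (fun i : Fin (1 + 1) => x (j + (i : ℕ))) = ![x j, x (j + 1)] := by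
    intro j
    funext i
    fin_cases i <;> simp
  simp only [h𝓕, Set.mem_ofPred_eq, hword]

theorem piecewise_mem (hX : X.IsStepSFT 1) {c d : ℤ} {x w : X} (hc : w.1 c = x.1 c)
    (hd : w.1 d = x.1 d) : (Set.Icc c d).piecewise w.1 x.1 ∈ X.carrier := by
  obtain ⟨R, hR⟩ := hX.exists_rel
  refine (hR _).2 fun j => ?_
  have hx := (hR _).1 x.2 j
  have hw := (hR _).1 w.2 j
  simp only [Set.piecewise, Set.mem_Icc]
  split_ifs with hj hj' hj'
  · exact hw
  · obtain rfl : j = d := by omega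
    rwa [hd]
  · obtain rfl : j + 1 = c := by omega
    rwa [hc]
  · exact hx

theorem concat_mem (hX : X.IsStepSFT 1) {p : ℤ} (hp : 0 < p) (s : ℤ → X)
    (hs : ∀ q, (s q).1 p = (s (q + 1)).1 0) : concat p (fun q => (s q).1) ∈ X.carrier := by
  obtain ⟨R, hR⟩ := hX.exists_rel
  refine (hR _).2 fun j => ?_
  obtain ⟨q, r, h₀, h₁, rfl⟩ : ∃ q r, 0 ≤ r ∧ r < p ∧ j = q * p + r :=
    ⟨_, _, Int.emod_nonneg j hp.ne', Int.emod_lt_of_pos j hp, (Int.ediv_mul_add_emod j p).symm⟩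
  have hr := (hR _).1 (s q).2 r
  rw [concat_apply _ q h₀ h₁]
  rcases (Int.add_one_le_iff.2 h₁).lt_or_eq with hlt | rfl
  · rwa [add_assoc, concat_apply _ q (by omega) hlt]
  · rwa [show q * (r + 1) + r + 1 = (q + 1) * (r + 1) + 0 by ring,
      concat_apply _ (q + 1) le_rfl hp, ← hs]

theorem exists_periodization (hX : X.IsStepSFT 1) {p : ℕ} (hp : 0 < p) {x : X}
    (hx : x.1 p = x.1 0) :
    ∃ z : X, Function.IsPeriodicPt X.shift p z ∧ z.1 = fun j => x.1 (j % p) := by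
  refine ⟨⟨_, hX.concat_mem (Int.natCast_pos.2 hp) (fun _ => x) fun _ => hx⟩, ?_, rfl⟩
  exact (X.isPeriodicPt_shift_iff _ p).2 fun j => congrArg x.1 (Int.add_emod_right j p)

end Subshift.IsStepSFT

end Shifts

/-! ### Minimal cost over a block -/

section Sums

theorem sum_range_mul {M : Type*} [AddCommMonoid M] (g : ℕ → M) (L p : ℕ) :
    ∑ j ∈ Finset.range (L * p), g j =
      ∑ q ∈ Finset.range L, ∑ r ∈ Finset.range p, g (q * p + r) := by
  induction L with
  | zero => simp
  | succ L ih => rw [Nat.succ_mul, Finset.sum_range_add, ih, Finset.sum_range_succ]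

theorem sum_Icc_int_eq_sum_range {M : Type*} [AddCommMonoid M] (g : ℤ → M) (a b : ℤ) :
    ∑ j ∈ Finset.Icc a b, g j = ∑ i ∈ Finset.range (b + 1 - a).toNat, g (a + i) :=
  Finset.sum_map _ _ _

theorem abs_sum_range_sub_sum_middle_le {g : ℕ → ℝ} {M : ℝ} (hg : ∀ j, |g j| ≤ M) (D n : ℕ) :
    |∑ j ∈ Finset.range (D + n + D), g j - ∑ j ∈ Finset.range n, g (D + j)| ≤ 2 * D * M := by
  have hmargin : ∀ c, |∑ j ∈ Finset.range D, g (c + j)| ≤ D * M := fun c => by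
    simpa using norm_sum_le_of_le (Finset.range D) fun j _ =>
      (Real.norm_eq_abs _).trans_le (hg (c + j))
  have hsplit : ∑ j ∈ Finset.range (D + n + D), g j - ∑ j ∈ Finset.range n, g (D + j) =
      ∑ j ∈ Finset.range D, g (0 + j) + ∑ j ∈ Finset.range D, g (D + n + j) := by
    simp only [Finset.sum_range_add, zero_add]
    ring
  rw [hsplit]
  linarith [abs_add_le (∑ j ∈ Finset.range D, g (0 + j)) (∑ j ∈ Finset.range D, g (D + n + j)),
    hmargin 0, hmargin (D + n)]

theorem finite_range_sum_cost {A B ι : Type*} [Finite A] (F : A → B → ℝ) (s : Finset ι)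
    (w : ι → B) : (Set.range fun u : ι → A => ∑ i ∈ s, F (u i) (w i)).Finite := by
  refine (Set.finite_range fun u : s → A => ∑ i : s, F (u i) (w i)).subset ?_
  rintro _ ⟨u, rfl⟩
  exact ⟨fun i => u i, Finset.sum_coe_sort s fun i => F (u i) (w i)⟩

theorem abs_sum_Icc_sub_sum_range_le {g : ℤ → ℝ} {M : ℝ} (hg : ∀ j, |g j| ≤ M) (D n : ℕ) :
    |∑ j ∈ Finset.Icc (-D : ℤ) (n - 1 + D), g j - ∑ j ∈ Finset.range n, g j| ≤ 2 * D * M := by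
  have hmargins := abs_sum_range_sub_sum_middle_le (fun j : ℕ => hg (-D + j)) D n
  rw [sum_Icc_int_eq_sum_range, show ((n : ℤ) - 1 + D + 1 - -D).toNat = D + n + D by omega]
  simpa only [Nat.cast_add, neg_add_cancel_left] using hmargins

theorem exists_abs_le {A B : Type*} [Finite A] [Finite B] (F : A → B → ℝ) :
    ∃ M, ∀ a b, |F a b| ≤ M := by
  obtain ⟨M, hM⟩ := (Set.finite_range fun p : A × B => |F p.1 p.2|).bddAbove
  exact ⟨M, fun a b => hM ⟨(a, b), rfl⟩⟩

theorem le_of_forall_nat_mul_le_mul_add {a b K : ℝ}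
    (h : ∀ n : ℕ, 0 < n → n * a ≤ n * b + K) : a ≤ b := by
  by_contra! hlt
  obtain ⟨n, hn⟩ := exists_nat_gt (max K 0 / (a - b))
  have hn₀ : (0 : ℝ) < n := (div_nonneg (le_max_right K 0) (sub_pos.2 hlt).le).trans_lt hn
  rw [div_lt_iff₀ (sub_pos.2 hlt)] at hn
  linarith [h n (Nat.cast_pos.1 hn₀), le_max_left K 0]

end Sums

section MinimalCost

variable {A B : Type*} [TopologicalSpace A]

/-- The minimum over the points `x` of `X` of the cost `∑ i < n, F (x i) (w i)` against the word
`w`. -/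
def wordMinCost (X : Subshift A) (F : A → B → ℝ) {n : ℕ} (w : Fin n → B) : ℝ :=
  ⨅ x : X, ∑ i : Fin n, F (x.1 (i : ℕ)) (w i)

/-- The minimum over the points `x` of `X` of the cost `∑ j < n, F (x j) (y j)` against the
sequence `y`, a version of `H` without boundary conditions. -/
def minCost (X : Subshift A) (F : A → B → ℝ) (n : ℕ) (y : ℤ → B) : ℝ :=
  wordMinCost X F fun i : Fin n => y (i : ℕ)

theorem minCost_eq_iInf (X : Subshift A) (F : A → B → ℝ) (n : ℕ) (y : ℤ → B) :
    minCost X F n y = ⨅ x : X, ∑ j ∈ Finset.range n, F (x.1 j) (y j) :=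
  iInf_congr fun x => Fin.sum_univ_eq_sum_range (fun j => F (x.1 j) (y j)) n

theorem birkhoffSum_eq_sum_cost [TopologicalSpace B] {X : Subshift A} {Y : Subshift B}
    {f : C(X × Y, ℝ)} {F : A → B → ℝ} (hf : ∀ x y, f (x, y) = F (x.1 0) (y.1 0)) (n : ℕ)
    (z : X × Y) :
    birkhoffSum (X.shift.prodCongr Y.shift) f n z =
      ∑ j ∈ Finset.range n, F (z.1.1 j) (z.2.1 j) := by
  refine Finset.sum_congr rfl fun j _ => ?_
  rw [Homeomorph.coe_prodCongr, Prod.map_iterate, Prod.map_apply', hf, X.shift_iterate_apply,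
    Y.shift_iterate_apply, zero_add]

variable [Finite A]

theorem exists_eq_wordMinCost (X : Subshift A) (F : A → B → ℝ) {n : ℕ} (w : Fin n → B) :
    ∃ x : X, ∑ i : Fin n, F (x.1 (i : ℕ)) (w i) = wordMinCost X F w := by
  have : Nonempty X := X.nonempty.to_subtype
  refine (Set.range_nonempty _).csInf_mem ((finite_range_sum_cost F Finset.univ w).subset ?_)
  rintro _ ⟨x, rfl⟩
  exact ⟨fun i => x.1 (i : ℕ), rfl⟩

theorem exists_eq_minCost (X : Subshift A) (F : A → B → ℝ) (n : ℕ) (y : ℤ → B) :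
    ∃ x : X, ∑ j ∈ Finset.range n, F (x.1 j) (y j) = minCost X F n y := by
  obtain ⟨x, hx⟩ := exists_eq_wordMinCost X F fun i : Fin n => y (i : ℕ)
  exact ⟨x, (Fin.sum_univ_eq_sum_range (fun j => F (x.1 j) (y j)) n).symm.trans hx⟩

theorem Subshift.IsGluingGap.exists_optimal_block {X : Subshift A} {D : ℕ} (hD : X.IsGluingGap D)
    (F : A → B → ℝ) {n : ℕ} (hn : 0 < n) (c : X) (w : Fin n → B) :
    ∃ ξ : X, ξ.1 0 = c.1 0 ∧ ξ.1 (D + n + D : ℕ) = c.1 0 ∧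
      ∑ i : Fin n, F (ξ.1 (D + i : ℕ)) (w i) = wordMinCost X F w := by
  obtain ⟨x, hx⟩ := exists_eq_wordMinCost X F w
  obtain ⟨ξ, hleft, hmid, hright⟩ := hD.exists_glue_middle c ((X.shift ^ (-D : ℤ)) x)
    ((X.shift ^ (-(D + n + D : ℕ) : ℤ)) c) (b₁ := 0) (a₂ := D) (b₂ := D + n - 1)
    (a₃ := (D + n + D : ℕ)) (by omega) (by omega) (by omega)
  refine ⟨ξ, hleft 0 le_rfl, ?_, ?_⟩
  · rw [hright _ le_rfl, X.shift_zpow_apply, add_neg_cancel]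
  · rw [← hx]
    refine Finset.sum_congr rfl fun i _ => ?_
    rw [hmid _ (by omega) (by omega), X.shift_zpow_apply, Nat.cast_add, add_neg_cancel_comm]

theorem minCost_le (X : Subshift A) (F : A → B → ℝ) (n : ℕ) (y : ℤ → B) (x : X) :
    minCost X F n y ≤ ∑ j ∈ Finset.range n, F (x.1 j) (y j) := by
  have hfin := finite_range_sum_cost F (Finset.range n) fun j => y j
  rw [minCost_eq_iInf]
  refine ciInf_le (hfin.subset ?_).bddBelow x
  rintro _ ⟨u, rfl⟩
  exact ⟨fun j => u.1 j, rfl⟩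

theorem abs_minCost_le (X : Subshift A) {F : A → B → ℝ} {M : ℝ} (hM : ∀ a b, |F a b| ≤ M)
    (n : ℕ) (y : ℤ → B) : |minCost X F n y| ≤ n * M := by
  obtain ⟨x, hx⟩ := exists_eq_minCost X F n y
  rw [← hx]
  simpa using norm_sum_le_of_le (Finset.range n) fun j _ =>
    (Real.norm_eq_abs _).trans_le (hM (x.1 j) (y j))

theorem abs_minCost_shift_sub_le (X : Subshift A) {F : A → B → ℝ} {M : ℝ}
    (hM : ∀ a b, |F a b| ≤ M) (n : ℕ) (y : ℤ → B) :
    |minCost X F n (fun j => y (j + 1)) - minCost X F n y| ≤ 2 * M := by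
  have hshift : ∀ x : ℤ → A, |∑ j ∈ Finset.range n, F (x (j + 1)) (y (j + 1)) -
      ∑ j ∈ Finset.range n, F (x j) (y j)| ≤ 2 * M := by
    intro x
    have htelescope := Finset.sum_range_sub (fun j : ℕ => F (x j) (y j)) n
    rw [Finset.sum_sub_distrib] at htelescope
    push_cast at htelescope
    rw [htelescope]
    linarith [abs_sub (F (x n) (y n)) (F (x 0) (y 0)), hM (x n) (y n), hM (x 0) (y 0)]
  refine abs_sub_le_iff.2 ⟨?_, ?_⟩
  · obtain ⟨x, hx⟩ := exists_eq_minCost X F n y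
    have hle := minCost_le X F n (fun j => y (j + 1)) (X.shift x)
    linarith [(abs_le.1 (hshift x.1)).2, show ∑ j ∈ Finset.range n, F ((X.shift x).1 j) (y (j + 1))
      = ∑ j ∈ Finset.range n, F (x.1 (j + 1)) (y (j + 1)) from rfl]
  · obtain ⟨x, hx⟩ := exists_eq_minCost X F n fun j => y (j + 1)
    have hle := minCost_le X F n y (X.shift.symm x)
    have hback : ∀ j, (X.shift.symm x).1 (j + 1) = x.1 j := fun j =>
      congrArg (fun u : X => u.1 j) (X.shift.apply_symm_apply x)
    have habs := (abs_le.1 (hshift (X.shift.symm x).1)).1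
    simp only [hback] at habs
    linarith

theorem abs_minCost_translate_sub_le (X : Subshift A) {F : A → B → ℝ} {M : ℝ}
    (hM : ∀ a b, |F a b| ≤ M) (n : ℕ) (y : ℤ → B) (i : ℤ) :
    |minCost X F n (fun j => y (j + i)) - minCost X F n y| ≤ 2 * M * |i| := by
  induction i with
  | zero => simp
  | succ i ih =>
    have hstep := abs_minCost_shift_sub_le X hM n fun j => y (j + i)
    simp only [show ∀ j : ℤ, j + 1 + i = j + (i + 1) from fun j => by ring] at hstep
    refine (abs_sub_le _ _ _).trans ((add_le_add hstep ih).trans_eq ?_)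
    rw [abs_of_nonneg (by positivity : (0 : ℤ) ≤ i + 1), Nat.abs_cast]
    push_cast
    ring
  | pred i ih =>
    have hstep := abs_minCost_shift_sub_le X hM n fun j => y (j + (-i - 1))
    simp only [show ∀ j : ℤ, j + 1 + (-i - 1) = j + -i from fun j => by ring] at hstep
    rw [abs_sub_comm] at hstep
    refine (abs_sub_le _ _ _).trans ((add_le_add hstep ih).trans_eq ?_)
    rw [abs_neg, Nat.abs_cast, show -(i : ℤ) - 1 = -(i + 1) by ring, abs_neg,
      abs_of_nonneg (by positivity : (0 : ℤ) ≤ i + 1)]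
    push_cast
    ring

theorem minCost_add_le_of_block {X : Subshift A} (hX : X.IsStepSFT 1) {F : A → B → ℝ} {p : ℕ}
    (hp : 0 < p) {u t : ℤ → B} {δ : ℝ}
    (h : ∀ x : X, ∃ x' : X, x'.1 0 = x.1 0 ∧ x'.1 p = x.1 p ∧
      ∑ r ∈ Finset.range p, F (x'.1 r) (u r) + δ ≤ ∑ r ∈ Finset.range p, F (x.1 r) (t r))
    (L : ℕ) :
    minCost X F (L * p) (fun j => u (j % p)) + L * δ ≤
      minCost X F (L * p) fun j => t (j % p) := by
  obtain ⟨x, hx⟩ := exists_eq_minCost X F (L * p) fun j => t (j % p)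
  choose s hs₀ hsp hs using fun q : ℤ => h ((X.shift ^ (q * p)) x)
  have hfit : ∀ q, (s q).1 p = (s (q + 1)).1 0 := fun q => by
    rw [hsp, hs₀, X.shift_zpow_apply, X.shift_zpow_apply]
    exact congrArg x.1 (by ring)
  have hmod : ∀ q r : ℕ, r < p → ((q * p + r : ℕ) : ℤ) % p = r := fun q r hr => by
    rw [← Int.natCast_mod, Nat.mul_add_mod_self_right, Nat.mod_eq_of_lt hr]
  have hu : ∑ j ∈ Finset.range (L * p), F (concat p (fun q => (s q).1) j) (u (j % p)) =
      ∑ q ∈ Finset.range L, ∑ r ∈ Finset.range p, F ((s q).1 r) (u r) := by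
    rw [sum_range_mul]
    refine Finset.sum_congr rfl fun q _ => Finset.sum_congr rfl fun r hr => ?_
    have hr' := Finset.mem_range.1 hr
    rw [hmod q r hr', Nat.cast_add, Nat.cast_mul,
      concat_apply _ _ (Int.natCast_nonneg r) (Int.ofNat_lt.2 hr')]
  have ht : ∑ j ∈ Finset.range (L * p), F (x.1 j) (t (j % p)) =
      ∑ q ∈ Finset.range L, ∑ r ∈ Finset.range p, F (((X.shift ^ (q * p : ℤ)) x).1 r) (t r) := by
    rw [sum_range_mul]
    refine Finset.sum_congr rfl fun q _ => Finset.sum_congr rfl fun r hr => ?_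
    rw [hmod q r (Finset.mem_range.1 hr), X.shift_zpow_apply, Nat.cast_add, Nat.cast_mul, add_comm]
  have hcat := minCost_le X F (L * p) (fun j => u (j % p))
    ⟨_, hX.concat_mem (Int.natCast_pos.2 hp) s hfit⟩
  have hsum := Finset.sum_le_sum fun q (_ : q ∈ Finset.range L) => hs q
  rw [Finset.sum_add_distrib, Finset.sum_const, Finset.card_range, nsmul_eq_mul, ← hu, ← ht, hx]
    at hsum
  linarith

end MinimalCost

/-! ### The value of `ψ_f` and minimal costs -/

section Measurability

variable {A B : Type*} [TopologicalSpace A] [MeasurableSpace A] [TopologicalSpace B]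
  [MeasurableSpace B]

namespace Subshift

theorem measurable_coord (X : Subshift A) (j : ℤ) : Measurable fun x : X => x.1 j :=
  (measurable_pi_apply j).comp measurable_subtype_coe

theorem measurable_of_coord {α : Type*} [MeasurableSpace α] {X : Subshift A} {g : α → X}
    (hg : ∀ j, Measurable fun a => (g a).1 j) : Measurable g :=
  Measurable.subtype_mk (measurable_pi_iff.2 hg)

theorem measurable_shift (X : Subshift A) : Measurable X.shift :=
  measurable_of_coord fun j => X.measurable_coord (j + 1)

theorem measurable_shift_zpow (X : Subshift A) (n : ℤ) : Measurable (X.shift ^ n : X ≃ₜ X) :=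
  measurable_of_coord fun j => by
    simpa only [X.shift_zpow_apply] using X.measurable_coord (j + n)

theorem measurable_of_window [Finite A] [MeasurableSingletonClass A] {α : Type*}
    [MeasurableSpace α] (X : Subshift A) {n : ℕ} (g : (Fin n → A) → α) (c : Fin n → ℤ) :
    Measurable fun x : X => g fun i => x.1 (c i) :=
  (Measurable.of_discrete (f := g)).comp (measurable_pi_iff.2 fun i => X.measurable_coord (c i))

theorem IsStepSFT.exists_measurable_semiconj {X : Subshift A} {Y : Subshift B}
    (hX : X.IsStepSFT 1) {N : ℕ} (hN : 0 < N) {ξ : Y → X} (hξ : Measurable ξ)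
    (hfit : ∀ y y', (ξ y).1 N = (ξ y').1 0) :
    ∃ Φ : Y → X, Measurable Φ ∧ Function.Semiconj Φ Y.shift^[N] X.shift^[N] ∧
      ∀ y, ∀ j < N, (Φ y).1 j = (ξ y).1 j := by
  -- `Φ y` concatenates the blocks that `ξ` chooses at the multiples of `N`.
  let block (y : Y) (q : ℤ) : X := ξ ((Y.shift ^ (q * N)) y)
  have hblock : ∀ y q, block (Y.shift^[N] y) q = block y (q + 1) := by
    intro y q
    refine congrArg ξ (Subtype.ext (funext fun j => ?_))
    rw [Y.shift_zpow_apply, Y.shift_iterate_apply, Y.shift_zpow_apply]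
    exact congrArg y.1 (by ring)
  have hN' : (0 : ℤ) < N := Int.natCast_pos.2 hN
  let Φ : Y → X := fun y => ⟨concat N fun q => (block y q).1, hX.concat_mem hN' _ fun q => hfit _ _⟩
  refine ⟨Φ, ?_, fun y => ?_, fun y j hj => ?_⟩
  · exact measurable_of_coord fun j =>
      (X.measurable_coord (j % N)).comp (hξ.comp (Y.measurable_shift_zpow (j / N * N)))
  · refine Subtype.ext (funext fun j => ?_)
    rw [X.shift_iterate_apply]
    simp only [Φ, concat, hblock, Int.add_emod_right, Int.add_ediv_of_dvd_right (dvd_refl _),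
      Int.ediv_self hN'.ne']
  · have hj' := concat_apply (fun q => (block y q).1) 0 (Int.natCast_nonneg j) (Int.ofNat_lt.2 hj)
    simpa only [block, zero_mul, zero_add, zpow_zero, Homeomorph.one_apply] using hj'

end Subshift

end Measurability

section MinimalCostIntegral

variable {A B : Type*} [TopologicalSpace A] [TopologicalSpace B] [MeasurableSpace B] [Finite B]
  [MeasurableSingletonClass B]

theorem measurable_minCost (X : Subshift A) (Y : Subshift B) (F : A → B → ℝ) (n : ℕ) :
    Measurable fun y : Y => minCost X F n y.1 :=
  Y.measurable_of_window (wordMinCost X F) _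

theorem integrable_minCost [Finite A] (X : Subshift A) {Y : Subshift B} (F : A → B → ℝ) (n : ℕ)
    (ν : Measure Y) [IsFiniteMeasure ν] :
    Integrable (fun y : Y => minCost X F n y.1) ν := by
  obtain ⟨M, hM⟩ := exists_abs_le F
  exact Integrable.of_bound (measurable_minCost X Y F n).aestronglyMeasurable (n * M)
    (Filter.Eventually.of_forall fun y => abs_minCost_le X hM n y.1)

theorem integral_minCost_comp_shift_iterate (X : Subshift A) {Y : Subshift B} (F : A → B → ℝ)
    {ν : Measure Y} (hν : MeasurePreserving Y.shift ν ν) (n m : ℕ) :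
    ∫ y, minCost X F n (Y.shift^[m] y).1 ∂ν = ∫ y : Y, minCost X F n y.1 ∂ν := by
  have hm := hν.iterate m
  rw [← integral_map (φ := Y.shift^[m]) (f := fun y : Y => minCost X F n y.1)
    hm.measurable.aemeasurable (measurable_minCost X Y F n).aestronglyMeasurable, hm.map_eq]

theorem abs_integral_minCost_averageMeasure_dirac_sub_le [Finite A] {X : Subshift A}
    {Y : Subshift B} {F : A → B → ℝ} {M : ℝ} (hM : ∀ a b, |F a b| ≤ M) {k : ℕ} (hk : 0 < k) (y : Y)
    (n : ℕ) :
    |∫ w : Y, minCost X F n w.1 ∂averageMeasure Y.shift k (Measure.dirac y) - minCost X F n y.1| ≤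
      2 * M * k := by
  obtain ⟨x⟩ := X.nonempty.to_subtype
  have hM₀ : 0 ≤ M := (abs_nonneg _).trans (hM (x.1 0) (y.1 0))
  rw [integral_averageMeasure_dirac Y.measurable_shift k y
    (measurable_minCost X Y F n).stronglyMeasurable]
  refine norm_birkhoffAverage_sub_le (g := fun w : Y => minCost X F n w.1) hk fun j hj => ?_
  have htranslate := abs_minCost_translate_sub_le X hM n y.1 j
  rw [Nat.abs_cast, Int.cast_natCast] at htranslate
  have hshift : (Y.shift^[j] y).1 = fun i => y.1 (i + j) := funext (Y.shift_iterate_apply y j)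
  rw [hshift]
  refine htranslate.trans ?_
  gcongr

end MinimalCostIntegral

section PsiBounds

variable {A B : Type*} [TopologicalSpace A] [MeasurableSpace A] [TopologicalSpace B]
  [MeasurableSpace B] {X : Subshift A} {Y : Subshift B} {f : C(X × Y, ℝ)} {F : A → B → ℝ}
  {M : ℝ} {D n : ℕ}

theorem measurable_of_eq_cost [Finite A] [MeasurableSingletonClass A] [Finite B]
    [MeasurableSingletonClass B] (hf : ∀ x y, f (x, y) = F (x.1 0) (y.1 0)) : Measurable f := by
  have hfactor : (f : X × Y → ℝ) = fun z => Function.uncurry F (z.1.1 0, z.2.1 0) :=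
    funext fun z => hf z.1 z.2
  rw [hfactor]
  exact (Measurable.of_discrete (f := Function.uncurry F)).comp
    (((X.measurable_coord 0).comp measurable_fst).prodMk
      ((Y.measurable_coord 0).comp measurable_snd))

theorem Subshift.IsGluingGap.exists_measurable_optimal_block [Finite A] [Finite B]
    [MeasurableSingletonClass B] (hD : X.IsGluingGap D) (Y : Subshift B) (F : A → B → ℝ)
    (hn : 0 < n) (c : X) :
    ∃ ξ : Y → X, Measurable ξ ∧ (∀ y, (ξ y).1 0 = c.1 0) ∧
      (∀ y, (ξ y).1 (D + n + D : ℕ) = c.1 0) ∧ ∀ y,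
        ∑ j ∈ Finset.range n, F ((ξ y).1 (D + j : ℕ)) (y.1 (D + j : ℕ)) =
          minCost X F n (Y.shift^[D] y).1 := by
  choose ξ hleft hright hopt using hD.exists_optimal_block F hn c
  refine ⟨fun y => ξ fun i => y.1 (D + i : ℕ), Y.measurable_of_window ξ _, fun y => hleft _,
    fun y => hright _, fun y => ?_⟩
  have hword : (fun i : Fin n => (Y.shift^[D] y).1 (i : ℕ)) =
      fun i : Fin n => y.1 (D + i : ℕ) := by
    funext i
    rw [Y.shift_iterate_apply, Nat.cast_add, add_comm]
  rw [minCost, hword, ← hopt, ← Fin.sum_univ_eq_sum_range fun j =>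
    F ((ξ fun i : Fin n => y.1 (D + i : ℕ)).1 (D + j : ℕ)) (y.1 (D + j : ℕ))]

theorem exists_semiconj_sum_cost_le [Finite A] [Finite B] [MeasurableSingletonClass B]
    (hX : X.IsStepSFT 1) (hD : X.IsGluingGap D) (Y : Subshift B) (hM : ∀ a b, |F a b| ≤ M)
    (hn : 0 < n) :
    ∃ Φ : Y → X, Measurable Φ ∧
      Function.Semiconj Φ Y.shift^[D + n + D] X.shift^[D + n + D] ∧
      ∀ y, ∑ j ∈ Finset.range (D + n + D), F ((Φ y).1 j) (y.1 j) ≤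
        minCost X F n (Y.shift^[D] y).1 + 2 * D * M := by
  obtain ⟨c⟩ := X.nonempty.to_subtype
  obtain ⟨ξ, hξ, hleft, hright, hopt⟩ := hD.exists_measurable_optimal_block Y F hn c
  obtain ⟨Φ, hΦ, hsemi, hΦξ⟩ := hX.exists_measurable_semiconj (by omega : 0 < D + n + D) hξ
    fun y y' => (hright y).trans (hleft y').symm
  refine ⟨Φ, hΦ, hsemi, fun y => ?_⟩
  have hmargins := abs_sum_range_sub_sum_middle_le (fun j : ℕ => hM ((ξ y).1 j) (y.1 j)) D n
  rw [Finset.sum_congr rfl fun j hj => by rw [hΦξ y j (Finset.mem_range.1 hj)], ← hopt]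
  linarith [(abs_le.1 hmargins).2]

section Measures

variable [Finite A] [MeasurableSingletonClass A] [Finite B] [MeasurableSingletonClass B]

theorem exists_joining_integral_le (hX : X.IsStepSFT 1) (hD : X.IsGluingGap D)
    (hf : ∀ x y, f (x, y) = F (x.1 0) (y.1 0)) (hM : ∀ a b, |F a b| ≤ M) {ν : Measure Y}
    (hν : ν ∈ invariantMeasures Y.shift) (hn : 0 < n) :
    ∃ μ ∈ invariantMeasures (X.shift.prodCongr Y.shift), μ.map Prod.snd = ν ∧
      (D + n + D : ℕ) * ∫ z, f z ∂μ ≤ ∫ y : Y, minCost X F n y.1 ∂ν + 2 * D * M := by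
  have ⟨_, hpres⟩ := hν
  have hN : 0 < D + n + D := by omega
  obtain ⟨Φ, hΦ, hsemi, hcost⟩ := exists_semiconj_sum_cost_le hX hD Y hM hn
  refine ⟨graphJoining X.shift Y.shift (D + n + D) Φ ν,
    graphJoining_mem_invariantMeasures X.measurable_shift hN hΦ hsemi hν,
    map_snd_graphJoining X.measurable_shift hN hΦ hpres, ?_⟩
  have hfM : ∀ z, ‖f z‖ ≤ M := fun z => (hf z.1 z.2).symm ▸ hM _ _
  have hfm := (measurable_of_eq_cost hf).stronglyMeasurable
  have hU := X.measurable_shift.prodMap Y.measurable_shift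
  have hint : Integrable (fun y : Y => minCost X F n (Y.shift^[D] y).1) ν :=
    (hpres.iterate D).integrable_comp_of_integrable (integrable_minCost X F n ν)
  calc (D + n + D : ℕ) * ∫ z, f z ∂graphJoining X.shift Y.shift (D + n + D) Φ ν
      = ∫ y, birkhoffSum (X.shift.prodCongr Y.shift) f (D + n + D) (Φ y, y) ∂ν := by
        rw [integral_graphJoining X.measurable_shift Y.measurable_shift hΦ hfm hfM,
          ← smul_eq_mul, natCast_smul_integral_birkhoffAverage hN]
    _ ≤ ∫ y, (minCost X F n (Y.shift^[D] y).1 + 2 * D * M) ∂ν :=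
        integral_mono (integrable_birkhoffSum_comp hU hfm hfM (hΦ.prodMk measurable_id) _ ν)
          (hint.add (integrable_const _)) fun y =>
            (birkhoffSum_eq_sum_cost hf _ _).trans_le (hcost y)
    _ = ∫ y : Y, minCost X F n y.1 ∂ν + 2 * D * M := by
        rw [integral_add hint (integrable_const _), integral_const, probReal_univ, one_smul,
          integral_minCost_comp_shift_iterate X F hpres]

theorem integral_minCost_map_snd_le (hf : ∀ x y, f (x, y) = F (x.1 0) (y.1 0))
    {μ : Measure (X × Y)} (hμ : μ ∈ invariantMeasures (X.shift.prodCongr Y.shift)) (hn : 0 < n) :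
    ∫ y : Y, minCost X F n y.1 ∂μ.map Prod.snd ≤ n * ∫ z, f z ∂μ := by
  obtain ⟨_, hpres⟩ := hμ
  obtain ⟨M, hM⟩ := exists_abs_le F
  have hfM : ∀ z, ‖f z‖ ≤ M := fun z => (hf z.1 z.2).symm ▸ hM _ _
  have hfm := (measurable_of_eq_cost hf).stronglyMeasurable
  have hint := integrable_birkhoffSum_comp hpres.measurable hfm hfM measurable_id n μ
  have := Measure.isProbabilityMeasure_map (μ := μ) measurable_snd.aemeasurable
  calc ∫ y : Y, minCost X F n y.1 ∂μ.map Prod.snd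
      = ∫ z : X × Y, minCost X F n z.2.1 ∂μ :=
        integral_map measurable_snd.aemeasurable (measurable_minCost X Y F n).aestronglyMeasurable
    _ ≤ ∫ z, birkhoffSum (X.shift.prodCongr Y.shift) f n z ∂μ :=
        integral_mono ((integrable_minCost X F n _).comp_measurable measurable_snd) hint fun z =>
          (minCost_le X F n z.2.1 z.1).trans_eq (birkhoffSum_eq_sum_cost hf n z).symm
    _ = n * ∫ z, f z ∂averageMeasure (X.shift.prodCongr Y.shift) n μ := by
        rw [integral_averageMeasure hpres.measurable n hfm fun j _ =>
            (hpres.iterate j).integrable_comp_of_integrable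
              (Integrable.of_bound hfm.aestronglyMeasurable M (Filter.Eventually.of_forall hfM)),
          ← smul_eq_mul, natCast_smul_integral_birkhoffAverage hn fun z => z]
    _ = n * ∫ z, f z ∂μ := by rw [averageMeasure_eq_self hn hpres]

theorem integral_minCost_le_mul_psi (hX : X.IsStepSFT 1) (hXt : X.IsTransitive)
    (hf : ∀ x y, f (x, y) = F (x.1 0) (y.1 0)) {ν : Measure Y}
    (hν : ν ∈ invariantMeasures Y.shift) (hn : 0 < n) :
    ∫ y : Y, minCost X F n y.1 ∂ν ≤ n * psi (X.shift.prodCongr Y.shift) Prod.snd f ν := by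
  obtain ⟨M, hM⟩ := exists_abs_le F
  obtain ⟨D, hD⟩ := hXt.exists_isGluingGap
  obtain ⟨μ, hμ, hμν, -⟩ := exists_joining_integral_le hX hD hf hM hν hn
  rw [← div_le_iff₀' (Nat.cast_pos.2 hn)]
  refine le_csInf ⟨_, μ, ⟨hμ, hμν⟩, rfl⟩ ?_
  rintro _ ⟨ρ, ⟨hρ, rfl⟩, rfl⟩
  rw [div_le_iff₀' (Nat.cast_pos.2 hn)]
  exact integral_minCost_map_snd_le hf hρ hn

theorem mul_psi_le_integral_minCost_add (hX : X.IsStepSFT 1) (hD : X.IsGluingGap D)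
    (hf : ∀ x y, f (x, y) = F (x.1 0) (y.1 0)) (hM : ∀ a b, |F a b| ≤ M) {ν : Measure Y}
    (hν : ν ∈ invariantMeasures Y.shift) (hn : 0 < n) :
    n * psi (X.shift.prodCongr Y.shift) Prod.snd f ν ≤
      ∫ y : Y, minCost X F n y.1 ∂ν + 4 * D * M := by
  have hbound : ∀ ρ ∈ invariantMeasures (X.shift.prodCongr Y.shift), -M ≤ ∫ z, f z ∂ρ := by
    rintro ρ ⟨_, -⟩
    have hnorm := norm_integral_le_of_norm_le_const (μ := ρ) (f := f) (C := M)
      (Filter.Eventually.of_forall fun z => (hf z.1 z.2).symm ▸ hM (z.1.1 0) (z.2.1 0))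
    rw [probReal_univ, mul_one] at hnorm
    exact (abs_le.1 hnorm).1
  obtain ⟨μ, hμ, hμν, hle⟩ := exists_joining_integral_le hX hD hf hM hν hn
  have hpsi : psi (X.shift.prodCongr Y.shift) Prod.snd f ν ≤ ∫ z, f z ∂μ := by
    refine csInf_le ⟨-M, ?_⟩ ⟨μ, ⟨hμ, hμν⟩, rfl⟩
    rintro _ ⟨ρ, ⟨hρ, -⟩, rfl⟩
    exact hbound ρ hρ
  have hmul := mul_le_mul_of_nonneg_left hpsi (Nat.cast_nonneg (α := ℝ) n)
  have hmargins := mul_le_mul_of_nonneg_left (hbound μ hμ) (Nat.cast_nonneg (α := ℝ) D)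
  push_cast at hle
  linarith

theorem abs_mul_psi_sub_minCost_le (hX : X.IsStepSFT 1) (hD : X.IsGluingGap D)
    (hf : ∀ x y, f (x, y) = F (x.1 0) (y.1 0)) (hM : ∀ a b, |F a b| ≤ M) {k : ℕ} (hk : 0 < k)
    {y : Y} (hy : Function.IsPeriodicPt Y.shift k y) (hn : 0 < n) :
    |n * psi (X.shift.prodCongr Y.shift) Prod.snd f (averageMeasure Y.shift k (Measure.dirac y)) -
      minCost X F n y.1| ≤ 4 * D * M + 2 * M * k := by
  have hν := (averageMeasure_dirac_mem_closedOrbitMeasures Y.measurable_shift hk hy).1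
  have hlower := integral_minCost_le_mul_psi hX ⟨D, hD⟩ hf hν hn
  have hupper := mul_psi_le_integral_minCost_add hX hD hf hM hν hn
  have horbit := abs_le.1 (abs_integral_minCost_averageMeasure_dirac_sub_le (X := X) hM hk y n)
  obtain ⟨x⟩ := X.nonempty.to_subtype
  have hM₀ : 0 ≤ D * M := mul_nonneg D.cast_nonneg ((abs_nonneg _).trans (hM (x.1 0) (y.1 0)))
  exact abs_le.2 ⟨by linarith [hM₀], by linarith⟩

end Measures

end PsiBounds

/-! ### Periodic ground states and maximizing orbits -/

section GroundStates

variable {A : Type*} [TopologicalSpace A] {X Y : Subshift A} {f : C(X × Y, ℝ)} {F : A → A → ℝ}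
  {M C : ℝ} {D n k p : ℕ} {a b : ℤ} {y y' : Y} {v : A × A}

theorem orbitSum_eq_sum_cost (hf : ∀ x y, f (x, y) = F (x.1 0) (y.1 0)) (a b : ℤ) (x : X)
    (y : Y) :
    orbitSum (X.shift.prodCongr Y.shift) f a b (x, y) =
      ∑ j ∈ Finset.Icc a b, F (x.1 j) (y.1 j) := by
  refine Finset.sum_congr rfl fun j _ => ?_
  rw [prodCongr_zpow_apply, hf, X.shift_zpow_apply, Y.shift_zpow_apply, zero_add]

theorem finite_image_orbitSum [Finite A] (hf : ∀ x y, f (x, y) = F (x.1 0) (y.1 0)) (a b : ℤ)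
    (y : Y) (s : Set X) :
    ((fun x : X => orbitSum (X.shift.prodCongr Y.shift) f a b (x, y)) '' s).Finite := by
  refine (finite_range_sum_cost F (Finset.Icc a b) y.1).subset ?_
  rintro _ ⟨x, -, rfl⟩
  exact ⟨x.1, (orbitSum_eq_sum_cost hf a b x y).symm⟩

theorem minSum_le [Finite A] (hf : ∀ x y, f (x, y) = F (x.1 0) (y.1 0)) {x : X}
    (ha : x.1 a = v.1) (hb : x.1 b = v.2) (y : Y) :
    minSum X Y f a b v y ≤ ∑ j ∈ Finset.Icc a b, F (x.1 j) (y.1 j) := by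
  rw [← orbitSum_eq_sum_cost hf]
  exact csInf_le (finite_image_orbitSum hf a b y _).bddBelow ⟨x, ⟨ha, hb⟩, rfl⟩

theorem exists_eq_minSum [Finite A] (hf : ∀ x y, f (x, y) = F (x.1 0) (y.1 0))
    (hv : v ∈ endpointPairs X a b) (y : Y) :
    ∃ x : X, x.1 a = v.1 ∧ x.1 b = v.2 ∧
      ∑ j ∈ Finset.Icc a b, F (x.1 j) (y.1 j) = minSum X Y f a b v y := by
  obtain ⟨x, ⟨ha, hb⟩, hx⟩ :=
    (Set.Nonempty.image _ hv).csInf_mem (finite_image_orbitSum hf a b y _)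
  exact ⟨x, ha, hb, (orbitSum_eq_sum_cost hf a b x y).symm.trans hx⟩

theorem minCost_le_minSum_add [Finite A] (hf : ∀ x y, f (x, y) = F (x.1 0) (y.1 0))
    (hM : ∀ a b, |F a b| ≤ M) (hv : v ∈ endpointPairs X (-D) (n - 1 + D)) (y : Y) :
    minCost X F n y.1 ≤ minSum X Y f (-D) (n - 1 + D) v y + 2 * D * M := by
  obtain ⟨x, -, -, hx⟩ := exists_eq_minSum hf hv y
  have hmargins := abs_sum_Icc_sub_sum_range_le (fun j => hM (x.1 j) (y.1 j)) D n
  linarith [(abs_le.1 hmargins).1, minCost_le X F n y.1 x]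

theorem minSum_le_minCost_add [Finite A] (hD : X.IsGluingGap D)
    (hf : ∀ x y, f (x, y) = F (x.1 0) (y.1 0)) (hM : ∀ a b, |F a b| ≤ M) (hn : 0 < n)
    (hv : v ∈ endpointPairs X (-D) (n - 1 + D)) (y : Y) :
    minSum X Y f (-D) (n - 1 + D) v y ≤ minCost X F n y.1 + 2 * D * M := by
  obtain ⟨c, hca, hcb⟩ := hv
  obtain ⟨x, hx⟩ := exists_eq_minCost X F n y.1
  obtain ⟨x', hleft, hmid, hright⟩ := hD.exists_glue_middle c x c (b₁ := -D) (a₂ := 0)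
    (b₂ := n - 1) (a₃ := n - 1 + D) (by omega) (by omega) (by omega)
  have hle := minSum_le hf ((hleft _ le_rfl).trans hca) ((hright _ le_rfl).trans hcb) y
  have hmargins := abs_sum_Icc_sub_sum_range_le (fun j => hM (x'.1 j) (y.1 j)) D n
  have hcost : ∑ j ∈ Finset.range n, F (x'.1 j) (y.1 j) = minCost X F n y.1 :=
    hx ▸ Finset.sum_congr rfl fun j hj => by
      rw [hmid j (by omega) (by have := Finset.mem_range.1 hj; omega)]
  linarith [(abs_le.1 hmargins).2]

theorem minCost_le_of_mem_groundStates [Finite A] (hDX : X.IsGluingGap D)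
    (hDY : Y.IsGluingGap D) (hf : ∀ x y, f (x, y) = F (x.1 0) (y.1 0))
    (hM : ∀ a b, |F a b| ≤ M) (hn : 0 < n) (hy : y ∈ groundStates X Y f C) (z : Y) :
    minCost X F n z.1 ≤ minCost X F n y.1 + (4 * D * M + C) := by
  by_contra! hlt
  obtain ⟨y', hleft, hmid, hright⟩ := hDY.exists_glue_middle y z y (b₁ := -D) (a₂ := 0)
    (b₂ := n - 1) (a₃ := n - 1 + D) (by omega) (by omega) (by omega)
  refine hy (-D) (n - 1 + D) (by omega) ⟨y', fun j hj => ?_, fun v hv => ?_⟩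
  · rcases le_total j (-D) with hj' | hj'
    · exact (hleft j hj').symm
    · exact (hright j (le_of_not_ge fun h => hj ⟨hj', h⟩)).symm
  · have hz : minCost X F n y'.1 = minCost X F n z.1 :=
      congrArg (wordMinCost X F) (funext fun i => hmid _ (by omega) (by omega))
    linarith [minSum_le_minCost_add hDX hf hM hn hv y, minCost_le_minSum_add hf hM hv y']

theorem isAlphaMaximizing_of_mem_groundStates [Finite A] [MeasurableSpace A]
    [MeasurableSingletonClass A] (hX : X.IsStepSFT 1) (hXt : X.IsTransitive)
    (hYt : Y.IsTransitive) (hf : ∀ x y, f (x, y) = F (x.1 0) (y.1 0)) (hk : 0 < k)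
    (hper : Function.IsPeriodicPt Y.shift k y) (hy : y ∈ groundStates X Y f C) :
    IsAlphaMaximizing (X.shift.prodCongr Y.shift) Y.shift Prod.snd f
      (averageMeasure Y.shift k (Measure.dirac y)) := by
  obtain ⟨M, hM⟩ := exists_abs_le F
  obtain ⟨D₁, hD₁⟩ := hXt.exists_isGluingGap
  obtain ⟨D₂, hD₂⟩ := hYt.exists_isGluingGap
  set D := D₁ + D₂
  have hDX : X.IsGluingGap D := hD₁.mono (Nat.le_add_right _ _)
  have hDY : Y.IsGluingGap D := hD₂.mono (Nat.le_add_left _ _)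
  refine ⟨(averageMeasure_dirac_mem_closedOrbitMeasures Y.measurable_shift hk hper).1,
    fun ν hν => le_of_forall_nat_mul_le_mul_add (K := 12 * D * M + 2 * M * k + C) fun n hn => ?_⟩
  have := hν.1
  have hν_le := mul_psi_le_integral_minCost_add hX hDX hf hM hν hn
  have hint : ∫ z : Y, minCost X F n z.1 ∂ν ≤ minCost X F n y.1 + (4 * D * M + C) := by
    refine (integral_mono (integrable_minCost X F n ν) (integrable_const _) fun z =>
      minCost_le_of_mem_groundStates hDX hDY hf hM hn hy z).trans_eq ?_
    rw [integral_const, probReal_univ, one_smul]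
  linarith [(abs_le.1 (abs_mul_psi_sub_minCost_le hX hDX hf hM hk hper hn)).1]

namespace IsImprovement

theorem exists_minSum_add_le [Finite A] (h : IsImprovement X Y f C a b y y') (hC : 0 ≤ C) :
    ∃ δ > 0, ∀ v ∈ endpointPairs X a b, minSum X Y f a b v y + δ ≤ minSum X Y f a b v y' := by
  obtain ⟨x⟩ := X.nonempty.to_subtype
  obtain ⟨v, hv, hmin⟩ := Set.exists_min_image (endpointPairs X a b)
    (fun v => minSum X Y f a b v y' - minSum X Y f a b v y) (Set.toFinite _)
    ⟨(x.1 a, x.1 b), x, rfl, rfl⟩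
  exact ⟨minSum X Y f a b v y' - minSum X Y f a b v y, by linarith [h.2 v hv],
    fun w hw => by linarith [hmin w hw]⟩

theorem exists_sum_add_le [Finite A] (h : IsImprovement X Y f C a b y y') (hX : X.IsStepSFT 1)
    (hf : ∀ x y, f (x, y) = F (x.1 0) (y.1 0)) (hC : 0 ≤ C) :
    ∃ δ > 0, ∀ x : X, ∃ x' : X, (∀ j ∉ Set.Icc a b, x'.1 j = x.1 j) ∧
      ∀ s : Finset ℤ, Finset.Icc a b ⊆ s →
        ∑ j ∈ s, F (x'.1 j) (y.1 j) + δ ≤ ∑ j ∈ s, F (x.1 j) (y'.1 j) := by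
  obtain ⟨δ, hδ, hgap⟩ := h.exists_minSum_add_le hC
  refine ⟨δ, hδ, fun x => ?_⟩
  have hv : (x.1 a, x.1 b) ∈ endpointPairs X a b := ⟨x, rfl, rfl⟩
  obtain ⟨w, hwa, hwb, hw⟩ := exists_eq_minSum hf hv y
  refine ⟨⟨_, hX.piecewise_mem hwa hwb⟩, fun j hj => Set.piecewise_eq_of_notMem _ _ _ hj,
    fun s hs => ?_⟩
  have hinside : ∑ j ∈ Finset.Icc a b, F ((Set.Icc a b).piecewise w.1 x.1 j) (y.1 j) + δ ≤
      ∑ j ∈ Finset.Icc a b, F (x.1 j) (y'.1 j) := by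
    have hpiece : ∀ j ∈ Finset.Icc a b, (Set.Icc a b).piecewise w.1 x.1 j = w.1 j := fun j hj =>
      Set.piecewise_eq_of_mem _ _ _ (Finset.mem_Icc.1 hj)
    rw [Finset.sum_congr rfl fun j hj => by rw [hpiece j hj], hw]
    exact (hgap _ hv).trans (minSum_le hf rfl rfl y')
  have houtside : ∑ j ∈ s \ Finset.Icc a b, F ((Set.Icc a b).piecewise w.1 x.1 j) (y.1 j) =
      ∑ j ∈ s \ Finset.Icc a b, F (x.1 j) (y'.1 j) :=
    Finset.sum_congr rfl fun j hj => by
      have hj' : j ∉ Set.Icc a b := fun hmem => (Finset.mem_sdiff.1 hj).2 (Finset.mem_Icc.2 hmem)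
      rw [Set.piecewise_eq_of_notMem _ _ _ hj', h.1 j hj']
  rw [← Finset.sum_sdiff hs, ← Finset.sum_sdiff hs]
  linarith

theorem exists_block_add_le [Finite A] (h : IsImprovement X Y f C a b y y')
    (hX : X.IsStepSFT 1) (hf : ∀ x y, f (x, y) = F (x.1 0) (y.1 0)) (hC : 0 ≤ C)
    (hp : b - a + 2 ≤ p) :
    ∃ δ > 0, ∀ x : X, ∃ x' : X, x'.1 0 = x.1 0 ∧ x'.1 p = x.1 p ∧
      ∑ j ∈ Finset.range p, F (x'.1 j) (y.1 (j + (a - 1))) + δ ≤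
        ∑ j ∈ Finset.range p, F (x.1 j) (y'.1 (j + (a - 1))) := by
  obtain ⟨δ, hδ, hgain⟩ := h.exists_sum_add_le hX hf hC
  refine ⟨δ, hδ, fun x => ?_⟩
  obtain ⟨x', hx', hsum⟩ := hgain ((X.shift ^ (-(a - 1))) x)
  -- The window starts at `a - 1` because the improved point may differ at `a`.
  have hblock : ∀ g : ℤ → ℝ, ∑ j ∈ Finset.Icc (a - 1) (a - 2 + p), g j =
      ∑ j ∈ Finset.range p, g (j + (a - 1)) := by
    intro g
    rw [sum_Icc_int_eq_sum_range, show (a - 2 + p + 1 - (a - 1)).toNat = p by omega]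
    exact Finset.sum_congr rfl fun j _ => congrArg g (add_comm _ _)
  refine ⟨(X.shift ^ (a - 1)) x', ?_, ?_, ?_⟩
  · rw [X.shift_zpow_apply, hx' _ fun hmem => by have := hmem.1; omega, X.shift_zpow_apply,
      add_neg_cancel_right]
  · rw [X.shift_zpow_apply, hx' _ fun hmem => by have := hmem.2; omega, X.shift_zpow_apply,
      add_neg_cancel_right]
  · have hgain' := hsum _ (Finset.Icc_subset_Icc (sub_one_lt a).le (by omega : b ≤ a - 2 + p))
    simpa only [hblock, X.shift_zpow_apply, add_neg_cancel_right] using hgain'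

theorem exists_periodic_minCost_add_le [Finite A] (h : IsImprovement X Y f C a b y y')
    (hX : X.IsStepSFT 1) (hY : Y.IsStepSFT 1) (hf : ∀ x y, f (x, y) = F (x.1 0) (y.1 0))
    (hC : 0 ≤ C) (hp₀ : 0 < p) (hp : b - a + 2 ≤ p) (hper : Function.IsPeriodicPt Y.shift p y) :
    ∃ δ > 0, ∃ z : Y, Function.IsPeriodicPt Y.shift p z ∧ ∀ L : ℕ,
      minCost X F (L * p) (fun j => y.1 (j + (a - 1))) + L * δ ≤ minCost X F (L * p) z.1 := by
  have hperiod : Function.Periodic y.1 p := (Y.isPeriodicPt_shift_iff y p).1 hper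
  have hends : ((Y.shift ^ (a - 1)) y').1 p = ((Y.shift ^ (a - 1)) y').1 0 := by
    rw [Y.shift_zpow_apply, Y.shift_zpow_apply, ← h.1 _ fun hmem => by have := hmem.2; omega,
      ← h.1 _ fun hmem => by have := hmem.1; omega, add_comm, hperiod, zero_add]
  obtain ⟨z, hzper, hz⟩ := hY.exists_periodization hp₀ hends
  obtain ⟨δ, hδ, hblock⟩ := h.exists_block_add_le hX hf hC hp
  refine ⟨δ, hδ, z, hzper, fun L => ?_⟩
  have hfold : (fun j => y.1 (j + (a - 1))) = fun j => y.1 (j % p + (a - 1)) := by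
    funext j
    have hj := hperiod.int_mul (j / p) (j % p + (a - 1))
    rwa [Int.cast_id, add_right_comm, Int.emod_add_ediv_mul] at hj
  rw [hz, hfold]
  simp only [Y.shift_zpow_apply]
  exact minCost_add_le_of_block hX hp₀ (u := fun j => y.1 (j + (a - 1)))
    (t := fun j => y'.1 (j + (a - 1))) hblock L

end IsImprovement

theorem mem_groundStates_of_isAlphaMaximizing [Finite A] [MeasurableSpace A]
    [MeasurableSingletonClass A] (hX : X.IsStepSFT 1) (hY : Y.IsStepSFT 1)
    (hXt : X.IsTransitive) (hf : ∀ x y, f (x, y) = F (x.1 0) (y.1 0)) (hC : 0 ≤ C) (hk : 0 < k)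
    (hper : Function.IsPeriodicPt Y.shift k y)
    (hmax : IsAlphaMaximizing (X.shift.prodCongr Y.shift) Y.shift Prod.snd f
      (averageMeasure Y.shift k (Measure.dirac y))) :
    y ∈ groundStates X Y f C := by
  rintro a b hab ⟨y', himp⟩
  obtain ⟨p, hp, hlen, hperp⟩ :
      ∃ p : ℕ, 0 < p ∧ b - a + 2 ≤ p ∧ Function.IsPeriodicPt Y.shift p y := by
    refine ⟨k * (b - a + 2).toNat, Nat.mul_pos hk (by omega), ?_, hper.mul_const _⟩
    exact (Int.self_le_toNat _).trans (Int.ofNat_le.2 (Nat.le_mul_of_pos_left _ hk))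
  obtain ⟨δ, hδ, z, hz, hgain⟩ :=
    himp.exists_periodic_minCost_add_le hX hY hf hC hp hlen hperp
  obtain ⟨M, hM⟩ := exists_abs_le F
  obtain ⟨D, hD⟩ := hXt.exists_isGluingGap
  have hle := hmax.2 _ (averageMeasure_dirac_mem_closedOrbitMeasures Y.measurable_shift hp hz).1
  set ψy := psi (X.shift.prodCongr Y.shift) Prod.snd f (averageMeasure Y.shift k (Measure.dirac y))
  set ψz := psi (X.shift.prodCongr Y.shift) Prod.snd f (averageMeasure Y.shift p (Measure.dirac z))
  have hlt : p * ψy + δ ≤ p * ψz := by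
    refine le_of_forall_nat_mul_le_mul_add
      (K := 8 * D * M + 2 * M * k + 2 * M * p + 2 * M * |a - 1|) fun L hL => ?_
    have hLp : 0 < L * p := Nat.mul_pos hL hp
    have hy' := (abs_le.1 (abs_mul_psi_sub_minCost_le hX hD hf hM hk hper hLp)).2
    have hz' := (abs_le.1 (abs_mul_psi_sub_minCost_le hX hD hf hM hp hz hLp)).1
    have htranslate := (abs_le.1 (abs_minCost_translate_sub_le X hM (L * p) y.1 (a - 1))).1
    push_cast at hy' hz' htranslate ⊢
    linarith [hgain L]
  linarith [mul_le_mul_of_nonneg_left hle (Nat.cast_nonneg (α := ℝ) p)]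

end GroundStates

end AdversarialErgodic

end

theorem mainTheorem11 {A : Type*} [Finite A] [TopologicalSpace A] [DiscreteTopology A]
    [MeasurableSpace A] [BorelSpace A] (X Y : Subshift A)
    (hX : X.IsStepSFT 1) (hY : Y.IsStepSFT 1) (hXt : X.IsTransitive) (hYt : Y.IsTransitive)
    (f : C(X × Y, ℝ)) (hf : ∃ F : A → A → ℝ, ∀ (x : X) (y : Y), f (x, y) = F (x.1 0) (y.1 0))
    (C : ℝ) (hC : 0 ≤ C) :
    (∃ ν₀ ∈ closedOrbitMeasures Y.shift,
        IsAlphaMaximizing (X.shift.prodCongr Y.shift) Y.shift Prod.snd f ν₀) ↔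
      ∃ y ∈ groundStates X Y f C, y ∈ Function.periodicPts Y.shift := by
  obtain ⟨F, hF⟩ := hf
  constructor
  · rintro ⟨_, ⟨-, k, hk, y, hper, rfl⟩, hmax⟩
    exact ⟨y, mem_groundStates_of_isAlphaMaximizing hX hY hXt hF hC hk hper hmax, k, hk, hper⟩
  · rintro ⟨y, hy, k, hk, hper⟩
    exact ⟨_, averageMeasure_dirac_mem_closedOrbitMeasures Y.measurable_shift hk hper,
      isAlphaMaximizing_of_mem_groundStates hX hXt hYt hF hk hper hy⟩
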